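/- Let $B\subset\mathbb{C}^3$ be Beloshapka's cubic, the $4$-dimensional real submanifold with equations $$w_1=\overline{w_1}+2i\,z\bar z,\qquad w_2=\overline{w_2}+2i\,z\bar z\,(z+\bar z),$$ with the CR structure induced from $\mathbb{C}^3$. For every nonempty connected open subset $U\subseteq B$ (in particular for $U=B$), the real Lie algebra $\mathfrak{g}=\mathfrak{aut}_{CR}(U)$ of infinitesimal CR-automorphisms of $U$, that is, of smooth real vector fields $X$ on $U$ with $[X,\Gamma(T^{1,0}U)]\subseteq\Gamma(T^{1,0}U)$, has dimension $5$. Moreover, the complex vector space $\mathrm{Hom}_{\mathbb{R}}(\mathfrak{g},\mathbb{C})$ of complex-valued Maurer–Cartan forms of $\mathfrak{g}$ (left-invariant $1$-forms, with exterior derivative $d\theta(X,Y)=-\theta([X,Y])$) has a basis $\sigma,\rho,\zeta,\overline{\zeta},\alpha$, in which $\sigma,\rho,\alpha$ are real and $\overline{\zeta}$ is the complex conjugate of $\zeta$, satisfying the structure equations $$\begin{aligned} d\sigma&=3\,\alpha\wedge\sigma+\rho\wedge\zeta+\rho\wedge\overline{\zeta},\\ d\rho&=2\,\alpha\wedge\rho+i\,\zeta\wedge\overline{\zeta},\\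 d\zeta&=\alpha\wedge\zeta,\\ d\overline{\zeta}&=\alpha\wedge\overline{\zeta},\\ d\alpha&=0. \end{aligned}$$ -/

import Mathlib

open scoped ContDiff ComplexConjugate
open Complex

noncomputable section

/-! ### The Lie algebra of smooth vector fields on an open subset of a Banach space -/

section SmoothVectorFields

variable {E : Type*} [NormedAddCommGroup E] [NormedSpace ℝ E]

/-- Smooth real vector fields on an open set `V` of a real Banach space `E`. A field on `V` is
represented by its extension by zero to `E`, so that two fields are equal if and only if they
agree on `V`. -/
def smoothFieldSubmodule (V : TopologicalSpace.Opens E) : Submodule ℝ (E → E) where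
  carrier := {X | ContDiffOn ℝ ∞ X V ∧ ∀ x, x ∉ V → X x = 0}
  add_mem' := fun {X Y} hX hY =>
    ⟨hX.1.add hY.1, fun x hx => by simp [hX.2 x hx, hY.2 x hx]⟩
  zero_mem' := ⟨contDiffOn_const, fun _ _ => rfl⟩
  smul_mem' := fun c X hX =>
    ⟨contDiffOn_const.smul hX.1, fun x hx => by simp [hX.2 x hx]⟩

/-- The real vector space of smooth real vector fields on the open set `V`. -/
abbrev SmoothField (V : TopologicalSpace.Opens E) : Type _ := smoothFieldSubmodule V

namespace SmoothField

variable {V : TopologicalSpace.Opens E}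

instance : CoeFun (SmoothField V) (fun _ => E → E) := ⟨fun X => X.1⟩

theorem contDiffAt (X : SmoothField V) {x : E} (hx : x ∈ V) : ContDiffAt ℝ ∞ X x :=
  X.2.1.contDiffAt (V.isOpen.mem_nhds hx)

theorem differentiableAt (X : SmoothField V) {x : E} (hx : x ∈ V) : DifferentiableAt ℝ X x :=
  (X.contDiffAt hx).differentiableAt (by simp)

theorem ext_on {X Y : SmoothField V} (h : ∀ x ∈ V, X x = Y x) : X = Y := by
  apply Subtype.ext
  funext x
  by_cases hx : x ∈ V
  · exact h x hx
  · rw [X.2.2 x hx, Y.2.2 x hx]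

open Classical in
/-- The Lie bracket `[X, Y] = DY(X) - DX(Y)` of two smooth vector fields on `V`. -/
instance : Bracket (SmoothField V) (SmoothField V) where
  bracket X Y :=
    ⟨fun x => if x ∈ V then VectorField.lieBracket ℝ X Y x else 0, by
      refine ⟨?_, fun x hx => by simp [hx]⟩
      have h : ContDiffOn ℝ ∞ (VectorField.lieBracket ℝ X Y) V := fun x hx =>
        ((X.contDiffAt hx).lieBracket_vectorField (m := ∞) (Y.contDiffAt hx)
          (by simp)).contDiffWithinAt
      exact h.congr fun x hx => if_pos hx⟩

theorem bracket_apply (X Y : SmoothField V) {x : E} (hx : x ∈ V) :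
    (⁅X, Y⁆ : SmoothField V) x = VectorField.lieBracket ℝ X Y x := if_pos hx

theorem bracket_eventuallyEq (X Y : SmoothField V) {x : E} (hx : x ∈ V) :
    ((⁅X, Y⁆ : SmoothField V) : E → E) =ᶠ[nhds x] VectorField.lieBracket ℝ X Y := by
  filter_upwards [V.isOpen.mem_nhds hx] with y hy using bracket_apply X Y hy

variable [CompleteSpace E]

instance : LieRing (SmoothField V) where
  add_lie X Y Z := ext_on fun x hx => by
    change _ = (⁅X, Z⁆ : SmoothField V) x + (⁅Y, Z⁆ : SmoothField V) x
    rw [bracket_apply _ _ hx, bracket_apply _ _ hx, bracket_apply _ _ hx]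
    exact VectorField.lieBracket_add_left (X.differentiableAt hx) (Y.differentiableAt hx)
  lie_add X Y Z := ext_on fun x hx => by
    change _ = (⁅X, Y⁆ : SmoothField V) x + (⁅X, Z⁆ : SmoothField V) x
    rw [bracket_apply _ _ hx, bracket_apply _ _ hx, bracket_apply _ _ hx]
    exact VectorField.lieBracket_add_right (Y.differentiableAt hx) (Z.differentiableAt hx)
  lie_self X := ext_on fun x hx => by
    rw [bracket_apply _ _ hx, VectorField.lieBracket_eq]
    simp
  leibniz_lie X Y Z := ext_on fun x hx => by
    change _ = (⁅⁅X, Y⁆, Z⁆ : SmoothField V) x + (⁅Y, ⁅X, Z⁆⁆ : SmoothField V) x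
    rw [bracket_apply _ _ hx, bracket_apply _ _ hx, bracket_apply _ _ hx,
      (Filter.EventuallyEq.refl _ _).lieBracket_vectorField_eq (bracket_eventuallyEq Y Z hx),
      (bracket_eventuallyEq X Y hx).lieBracket_vectorField_eq (Filter.EventuallyEq.refl _ _),
      (Filter.EventuallyEq.refl _ _).lieBracket_vectorField_eq (bracket_eventuallyEq X Z hx)]
    exact VectorField.leibniz_identity_lieBracket (n := ∞)
      (by rw [minSmoothness_of_isRCLikeNormedField]; exact WithTop.coe_le_coe.2 le_top)
      (X.contDiffAt hx) (Y.contDiffAt hx) (Z.contDiffAt hx)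

instance : LieAlgebra ℝ (SmoothField V) where
  lie_smul c X Y := ext_on fun x hx => by
    change _ = c • (⁅X, Y⁆ : SmoothField V) x
    rw [bracket_apply _ _ hx, bracket_apply _ _ hx]
    exact VectorField.lieBracket_const_smul_right (Y.differentiableAt hx)

end SmoothField

end SmoothVectorFields

/-! ### Beloshapka's cubic and its CR structure -/

/-- Beloshapka's cubic in `ℂ³`, with coordinates `(z, w₁, w₂)`. -/
def cubic : Set (ℂ × ℂ × ℂ) :=
  {p | p.2.1 = conj p.2.1 + 2 * I * (p.1 * conj p.1) ∧
    p.2.2 = conj p.2.2 + 2 * I * (p.1 * conj p.1) * (p.1 + conj p.1)}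

/-- The global coordinates `(z, u₁, u₂)` on the cubic, where `uⱼ = Re wⱼ`. -/
abbrev Coord : Type := ℂ × ℝ × ℝ

/-- The cubic as a graph over the coordinates `(z, u₁, u₂)`. -/
def graphMap (x : Coord) : ℂ × ℂ × ℂ :=
  (x.1, x.2.1 + I * (x.1 * conj x.1), x.2.2 + I * (x.1 * conj x.1) * (x.1 + conj x.1))

theorem graphMap_mem (x : Coord) : graphMap x ∈ cubic := by
  constructor <;> simp [graphMap] <;> ring

theorem graphMap_of_mem {p : ℂ × ℂ × ℂ} (hp : p ∈ cubic) :
    graphMap (p.1, p.2.1.re, p.2.2.re) = p := by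
  obtain ⟨z, w₁, w₂⟩ := p
  obtain ⟨h₁, h₂⟩ := hp
  have e₁ := congrArg Complex.im h₁
  have e₂ := congrArg Complex.im h₂
  simp at e₁ e₂
  refine Prod.ext rfl (Prod.ext ?_ ?_)
  · apply Complex.ext
    · simp [graphMap]; ring
    · simp [graphMap]; linarith
  · apply Complex.ext
    · simp [graphMap, mul_comm]
    · simp [graphMap]; linarith

/-- The graph map is a homeomorphism onto the cubic, with inverse the restriction of the real
linear projection `(z, w₁, w₂) ↦ (z, Re w₁, Re w₂)`. -/
def graphHomeo : Coord ≃ₜ cubic where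
  toFun x := ⟨graphMap x, graphMap_mem x⟩
  invFun p := (p.1.1, p.1.2.1.re, p.1.2.2.re)
  left_inv x := by
    refine Prod.ext rfl (Prod.ext ?_ ?_) <;> simp [graphMap, mul_comm]
  right_inv p := Subtype.ext (graphMap_of_mem p.2)
  continuous_toFun := by
    refine Continuous.subtype_mk ?_ _
    unfold graphMap
    fun_prop
  continuous_invFun := by fun_prop

/-- The open subset of the coordinate space that corresponds to an open subset `U` of the cubic. -/
def coordDomain (U : TopologicalSpace.Opens cubic) : TopologicalSpace.Opens Coord :=
  U.comap ⟨graphHomeo, graphHomeo.continuous⟩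

/-- `IsCRPair Y Z` says that the smooth vector fields `Y` and `Z` on `U` are sections of the
complex tangent bundle `T^c = TB ∩ J(TB)` with `Z = J Y`, where `J` is multiplication by `i` in
`ℂ³`. Tangent vectors to the cubic are the images of the differential of the graph map, so a
field `Y` has such a partner `Z` exactly when it takes its values in `T^c`. Equivalently, the
complex vector field `Y - i Z` is a section of `T^{1,0}`. -/
def IsCRPair {U : TopologicalSpace.Opens cubic} (Y Z : SmoothField (coordDomain U)) : Prop :=
  ∀ x ∈ coordDomain U, fderiv ℝ graphMap x (Z x) = I • fderiv ℝ graphMap x (Y x)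

/-- The real Lie algebra of infinitesimal CR-automorphisms of an open subset `U` of the cubic:
the smooth real vector fields `X` on `U` whose Lie derivative preserves the CR structure, that
is, for every section `Y` of `T^c`, the field `[X, Y]` is again a section of `T^c`, and
`[X, J Y] = J [X, Y]`. Equivalently, `[X, Γ(T^{1,0})] ⊆ Γ(T^{1,0})`. -/
def autCR (U : TopologicalSpace.Opens cubic) : LieSubalgebra ℝ (SmoothField (coordDomain U)) where
  carrier := {X | ∀ Y Z : SmoothField (coordDomain U), IsCRPair Y Z → IsCRPair ⁅X, Y⁆ ⁅X, Z⁆}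
  add_mem' := fun {X X'} hX hX' Y Z h x hx => by
    have h₁ := hX Y Z h x hx
    have h₂ := hX' Y Z h x hx
    rw [add_lie, add_lie]
    change fderiv ℝ graphMap x (⁅X, Z⁆ x + ⁅X', Z⁆ x)
      = I • fderiv ℝ graphMap x (⁅X, Y⁆ x + ⁅X', Y⁆ x)
    rw [map_add, map_add, smul_add, h₁, h₂]
  zero_mem' := fun Y Z _ x hx => by
    rw [zero_lie, zero_lie]
    change fderiv ℝ graphMap x 0 = I • fderiv ℝ graphMap x 0
    simp
  smul_mem' := fun c X hX Y Z h x hx => by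
    have h₁ := hX Y Z h x hx
    rw [smul_lie, smul_lie]
    change fderiv ℝ graphMap x (c • ⁅X, Z⁆ x) = I • fderiv ℝ graphMap x (c • ⁅X, Y⁆ x)
    rw [map_smul, map_smul, h₁, smul_comm]
  lie_mem' := fun {X X'} hX hX' Y Z h x hx => by
    have h₁ := hX _ _ (hX' Y Z h) x hx
    have h₂ := hX' _ _ (hX Y Z h) x hx
    rw [lie_lie, lie_lie]
    change fderiv ℝ graphMap x (⁅X, ⁅X', Z⁆⁆ x - ⁅X', ⁅X, Z⁆⁆ x)
      = I • fderiv ℝ graphMap x (⁅X, ⁅X', Y⁆⁆ x - ⁅X', ⁅X, Y⁆⁆ x)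
    rw [map_sub, map_sub, smul_sub, h₁, h₂]

/-! ### Maurer–Cartan forms of a real Lie algebra -/

section MaurerCartan

variable (L : Type*) [LieRing L] [LieAlgebra ℝ L]

/-- The complex vector space of complex-valued Maurer–Cartan forms of a real Lie algebra `L`:
the complex-valued left-invariant `1`-forms on a Lie group with Lie algebra `L`, given by their
values on left-invariant vector fields. -/
abbrev MCForm : Type _ := L →ₗ[ℝ] ℂ

variable {L}

namespace MCForm

/-- The complex conjugate of a form. -/
def bar (θ : MCForm L) : MCForm L := (Complex.conjAe.toLinearMap) ∘ₗ θ

/-- The wedge product of two `1`-forms, as a `2`-form: `(θ ∧ η)(X, Y) = θ(X)η(Y) - θ(Y)η(X)`. -/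
def wedge (θ η : MCForm L) : L → L → ℂ := fun X Y => θ X * η Y - θ Y * η X

/-- The exterior derivative of a left-invariant `1`-form, evaluated on left-invariant vector
fields: `dθ(X, Y) = X(θ(Y)) - Y(θ(X)) - θ([X, Y]) = -θ([X, Y])`. -/
def d (θ : MCForm L) : L → L → ℂ := fun X Y => -θ ⁅X, Y⁆

end MCForm

end MaurerCartan

end

/-! ### Smooth functions and their derivatives along vector fields -/

/-! The algebra is squeezed between two copies of dimension 5.

Upper bound: the fields `frameX`, `frameY` (its image under `J`), `frameT`, `frameU` form a frame
with `[X,Y] = -4T`, `[X,T] = 4U`, `[Y,T] = [X,U] = 0`. For an infinitesimal automorphism `aX + bY +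
cT + dU`, preservation of the CR structure gives first-order linear equations along `X` and `Y`
(`autCR_equations`): `c` is determined by `d`, and `a`, `b` by `c`, while `a + ib` satisfies
tangential Cauchy–Riemann equations. Commuting derivatives (`prolongation`) yields `Ya = Xb = 0` and
shows that `Xa` is killed by `X` and `Y`. Since `X` and `Y` generate all directions by brackets,
`Xa` is constant on a connected set. The value of the field at one point together with `Xa` there,
five real numbers, then determines the field (`autCR_eq_zero`).

Lower bound: five explicit polynomial fields extend to holomorphic fields on `ℂ³`, so they are
automorphisms (`mem_autCR_of_holomorphic`). They comprise the weighted dilation, with weights 1, 2,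
3 on `z`, `w₁`, `w₂`, and four fields spanning the tangent space at each point. The bounds coincide,
so these fields are everything, and their brackets give the structure equations in a rescaled dual
basis. -/

/-- The second-derivative terms cancel by symmetry. It serves twice: for scalar `G` it gives
commutators of derivations, and for `graphMap` it moves brackets into `ℂ³`. -/
theorem fderiv_apply_lieBracket {E F : Type*} [NormedAddCommGroup E] [NormedSpace ℝ E]
    [NormedAddCommGroup F] [NormedSpace ℝ F] {G : E → F} {X Y : E → E} {x : E}
    (hG : ContDiffAt ℝ ∞ G x) (hX : DifferentiableAt ℝ X x) (hY : DifferentiableAt ℝ Y x) :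
    fderiv ℝ G x (VectorField.lieBracket ℝ X Y x) =
      fderiv ℝ (fun y => fderiv ℝ G y (Y y)) x (X x) -
        fderiv ℝ (fun y => fderiv ℝ G y (X y)) x (Y x) := by
  have hG' : DifferentiableAt ℝ (fderiv ℝ G) x :=
    (hG.fderiv_right (m := ∞) (by simp)).differentiableAt (by simp)
  have hsymm : IsSymmSndFDerivAt ℝ G x := hG.isSymmSndFDerivAt (by
    rw [minSmoothness_of_isRCLikeNormedField]; exact WithTop.coe_le_coe.2 le_top)
  rw [fderiv_clm_apply hG' hY, fderiv_clm_apply hG' hX, VectorField.lieBracket_eq]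
  simp [hsymm.eq (X x) (Y x)]

/-! ### Restrictions of globally defined fields. -/

namespace SmoothField

variable {E : Type*} [NormedAddCommGroup E] [NormedSpace ℝ E] {V : TopologicalSpace.Opens E}

open Classical in
/-- The restriction to `V` of a smooth vector field on the whole space. -/
noncomputable def restrict (V : TopologicalSpace.Opens E) (f : E → E) (hf : ContDiff ℝ ∞ f) :
    SmoothField V :=
  ⟨fun x => if x ∈ V then f x else 0,
    hf.contDiffOn.congr fun _ hx => if_pos hx, fun _ hx => if_neg hx⟩

theorem restrict_apply {f : E → E} (hf : ContDiff ℝ ∞ f) {x : E} (hx : x ∈ V) :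
    restrict V f hf x = f x := if_pos hx

theorem restrict_eventuallyEq {f : E → E} (hf : ContDiff ℝ ∞ f) {x : E} (hx : x ∈ V) :
    (restrict V f hf : E → E) =ᶠ[nhds x] f := by
  filter_upwards [V.isOpen.mem_nhds hx] with y hy using restrict_apply hf hy

theorem lie_restrict_apply (X : SmoothField V) {f : E → E} (hf : ContDiff ℝ ∞ f) {x : E}
    (hx : x ∈ V) :
    ⁅X, restrict V f hf⁆ x = fderiv ℝ f x (X x) - fderiv ℝ X x (f x) := by
  rw [bracket_apply _ _ hx, (Filter.EventuallyEq.refl _ _).lieBracket_vectorField_eq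
    (restrict_eventuallyEq hf hx), VectorField.lieBracket_eq]

theorem restrict_lie_restrict_apply {f g : E → E} (hf : ContDiff ℝ ∞ f) (hg : ContDiff ℝ ∞ g)
    {x : E} (hx : x ∈ V) :
    ⁅restrict V f hf, restrict V g hg⁆ x = fderiv ℝ g x (f x) - fderiv ℝ f x (g x) := by
  rw [lie_restrict_apply _ _ hx, restrict_apply hf hx, (restrict_eventuallyEq hf hx).fderiv_eq]

end SmoothField

section SmoothFunctions

variable {E : Type*} [NormedAddCommGroup E] [NormedSpace ℝ E]

/-- Smooth real functions on an open set `V`, represented by their extensions by zero. -/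
def smoothFunctionSubmodule (V : TopologicalSpace.Opens E) : Submodule ℝ (E → ℝ) where
  carrier := {g | ContDiffOn ℝ ∞ g V ∧ ∀ x, x ∉ V → g x = 0}
  add_mem' := fun {X Y} hX hY =>
    ⟨hX.1.add hY.1, fun x hx => by simp [hX.2 x hx, hY.2 x hx]⟩
  zero_mem' := ⟨contDiffOn_const, fun _ _ => rfl⟩
  smul_mem' := fun c X hX =>
    ⟨contDiffOn_const.smul hX.1, fun x hx => by simp [hX.2 x hx]⟩

/-- The real vector space of smooth real functions on the open set `V`. -/
abbrev SmoothFunction (V : TopologicalSpace.Opens E) : Type _ := smoothFunctionSubmodule V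

namespace SmoothFunction

variable {V : TopologicalSpace.Opens E}

theorem contDiffAt (g : SmoothFunction V) {x : E} (hx : x ∈ V) : ContDiffAt ℝ ∞ g.1 x :=
  g.2.1.contDiffAt (V.isOpen.mem_nhds hx)

theorem differentiableAt (g : SmoothFunction V) {x : E} (hx : x ∈ V) :
    DifferentiableAt ℝ g.1 x :=
  (g.contDiffAt hx).differentiableAt (by simp)

theorem ext_on {g h : SmoothFunction V} (H : ∀ x ∈ V, g.1 x = h.1 x) : g = h := by
  apply Subtype.ext
  funext x
  by_cases hx : x ∈ V
  · exact H x hx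
  · rw [g.2.2 x hx, h.2.2 x hx]

open Classical in
/-- The derivative of smooth functions along a smooth vector field. -/
noncomputable def derivAlong (X : SmoothField V) :
    SmoothFunction V →ₗ[ℝ] SmoothFunction V where
  toFun g := ⟨fun x => if x ∈ V then fderiv ℝ g.1 x (X x) else 0, by
    refine ⟨?_, fun x hx => by simp [hx]⟩
    have h : ContDiffOn ℝ ∞ (fun x => fderiv ℝ g.1 x (X x)) V := fun x hx =>
      (((g.contDiffAt hx).fderiv_right (m := ∞) (by simp)).clm_apply
        (X.contDiffAt hx)).contDiffWithinAt
    exact h.congr fun x hx => if_pos hx⟩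
  map_add' g h := ext_on fun x hx => by
    simp [hx, fderiv_add (g.differentiableAt hx) (h.differentiableAt hx)]
  map_smul' c g := ext_on fun x hx => by
    simp [hx, fderiv_const_smul (g.differentiableAt hx)]

theorem derivAlong_apply (X : SmoothField V) (g : SmoothFunction V) {x : E} (hx : x ∈ V) :
    (derivAlong X g).1 x = fderiv ℝ g.1 x (X x) := if_pos hx

theorem derivAlong_eventuallyEq (X : SmoothField V) (g : SmoothFunction V) {x : E}
    (hx : x ∈ V) : (derivAlong X g).1 =ᶠ[nhds x] fun y => fderiv ℝ g.1 y (X y) := by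
  filter_upwards [V.isOpen.mem_nhds hx] with y hy using derivAlong_apply X g hy

/-- Turns the brackets of the frame into operator identities on functions, the only input about the
frame that `prolongation` needs. -/
theorem derivAlong_lie (X Y : SmoothField V) (g : SmoothFunction V) :
    derivAlong X (derivAlong Y g) - derivAlong Y (derivAlong X g) = derivAlong ⁅X, Y⁆ g :=
  ext_on fun x hx => by
    change (derivAlong X (derivAlong Y g)).1 x - (derivAlong Y (derivAlong X g)).1 x = _
    rw [derivAlong_apply _ _ hx, derivAlong_apply _ _ hx, derivAlong_apply _ _ hx,
      SmoothField.bracket_apply _ _ hx,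
      fderiv_apply_lieBracket (g.contDiffAt hx) (X.differentiableAt hx) (Y.differentiableAt hx),
      (derivAlong_eventuallyEq Y g hx).fderiv_eq, (derivAlong_eventuallyEq X g hx).fderiv_eq]

theorem derivAlong_smul (c : ℝ) (X : SmoothField V) (g : SmoothFunction V) :
    derivAlong (c • X) g = c • derivAlong X g :=
  ext_on fun x hx => by
    change _ = c * (derivAlong X g).1 x
    rw [derivAlong_apply _ _ hx, derivAlong_apply _ _ hx]
    exact (fderiv ℝ g.1 x).map_smul c (X x)

theorem derivAlong_zero (g : SmoothFunction V) : derivAlong (0 : SmoothField V) g = 0 :=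
  ext_on fun x hx => by
    rw [derivAlong_apply _ _ hx]
    exact (fderiv ℝ g.1 x).map_zero

end SmoothFunction

end SmoothFunctions
/-- Prolongation of the equations for infinitesimal CR-automorphisms, in terms of the operators
of differentiation along a frame with the commutation relations of the cubic. -/
theorem prolongation {M : Type*} [AddCommGroup M] [Module ℝ M] {D₁ D₂ D₃ D₄ : M →ₗ[ℝ] M}
    (h₁₂ : ∀ g, D₁ (D₂ g) - D₂ (D₁ g) = (-4 : ℝ) • D₃ g)
    (h₁₃ : ∀ g, D₁ (D₃ g) - D₃ (D₁ g) = (4 : ℝ) • D₄ g)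
    (h₂₃ : ∀ g, D₂ (D₃ g) - D₃ (D₂ g) = 0)
    (h₁₄ : ∀ g, D₁ (D₄ g) - D₄ (D₁ g) = 0)
    {a b c d : M} (h₁c : D₁ c = (4 : ℝ) • b) (h₂c : D₂ c = (-4 : ℝ) • a)
    (h₁d : D₁ d = (-4 : ℝ) • c) (h₂d : D₂ d = 0) (hab : D₁ a = D₂ b) (hba : D₂ a = -D₁ b) :
    D₂ a = 0 ∧ D₁ b = 0 ∧ D₁ (D₁ a) = 0 ∧ D₂ (D₁ a) = 0 := by
  have h₃d : D₃ d = (4 : ℝ) • a := by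
    have h := h₁₂ d
    rw [h₁d, h₂d, map_smul, h₂c, map_zero] at h
    linear_combination (norm := module) (1 / 4 : ℝ) • h
  have h₃c : D₃ c = (2 : ℝ) • D₁ a := by
    have h := h₁₂ c
    rw [h₁c, h₂c, map_smul, map_smul, ← hab] at h
    linear_combination (norm := module) (1 / 4 : ℝ) • h
  have h₄d : D₄ d = (3 : ℝ) • D₁ a := by
    have h := h₁₃ d
    rw [h₁d, h₃d, map_smul, map_smul, h₃c] at h
    linear_combination (norm := module) (-1 / 4 : ℝ) • h
  -- Here the Cauchy–Riemann pair `a + ib` becomes rigid: `D₂` kills `d` and commutes with `D₃`, and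
  -- `D₃ d` is a multiple of `a`.
  have h₂a : D₂ a = 0 := by
    have h := h₂₃ d
    rw [h₂d, h₃d, map_smul, map_zero] at h
    linear_combination (norm := module) (1 / 4 : ℝ) • h
  have h₁b : D₁ b = 0 := by rw [← neg_eq_zero, ← hba, h₂a]
  have h₃a := h₁₂ a
  have h₂₁a := h₂₃ c
  rw [h₂a, map_zero] at h₃a
  rw [h₂c, h₃c, map_smul, map_smul] at h₂₁a
  have h₃b := h₁₂ b
  rw [h₁b, ← hab, map_zero] at h₃b
  have h₄c := h₁₃ c
  rw [h₁c, h₃c, map_smul, map_smul] at h₄c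
  have h₁₁a := h₁₄ d
  rw [h₁d, h₄d, map_smul, map_smul] at h₁₁a
  refine ⟨h₂a, h₁b, ?_, ?_⟩
  -- Three linear relations among `D₁ (D₁ a)`, `D₃ b` and `D₄ c`; their sum is `6 • D₁ (D₁ a) = 0`.
  · linear_combination (norm := module) (1 / 6 : ℝ) • h₁₁a + (1 / 6 : ℝ) • h₄c + (1 / 6 : ℝ) • h₃b
  -- Two relations between `D₂ (D₁ a)` and `D₃ a`; eliminating `D₃ a` leaves `3 • D₂ (D₁ a) = 0`.
  · linear_combination (norm := module) (1 / 3 : ℝ) • h₂₁a - (1 / 3 : ℝ) • h₃a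

/-! ### The coordinates, the graph map and the frame of the cubic -/

namespace Coord

theorem hasFDerivAt_re (x : Coord) : HasFDerivAt (fun x : Coord => x.1.re)
    (reCLM ∘L ContinuousLinearMap.fst ℝ ℂ (ℝ × ℝ)) x :=
  (reCLM ∘L ContinuousLinearMap.fst ℝ ℂ (ℝ × ℝ)).hasFDerivAt

theorem hasFDerivAt_im (x : Coord) : HasFDerivAt (fun x : Coord => x.1.im)
    (imCLM ∘L ContinuousLinearMap.fst ℝ ℂ (ℝ × ℝ)) x :=
  (imCLM ∘L ContinuousLinearMap.fst ℝ ℂ (ℝ × ℝ)).hasFDerivAt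

theorem hasFDerivAt_u₁ (x : Coord) : HasFDerivAt (fun x : Coord => x.2.1)
    (ContinuousLinearMap.fst ℝ ℝ ℝ ∘L ContinuousLinearMap.snd ℝ ℂ (ℝ × ℝ)) x :=
  (ContinuousLinearMap.fst ℝ ℝ ℝ ∘L ContinuousLinearMap.snd ℝ ℂ (ℝ × ℝ)).hasFDerivAt

theorem hasFDerivAt_u₂ (x : Coord) : HasFDerivAt (fun x : Coord => x.2.2)
    (ContinuousLinearMap.snd ℝ ℝ ℝ ∘L ContinuousLinearMap.snd ℝ ℂ (ℝ × ℝ)) x :=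
  (ContinuousLinearMap.snd ℝ ℝ ℝ ∘L ContinuousLinearMap.snd ℝ ℂ (ℝ × ℝ)).hasFDerivAt

@[fun_prop]
theorem contDiff_re : ContDiff ℝ ∞ (fun x : Coord => x.1.re) :=
  (reCLM ∘L ContinuousLinearMap.fst ℝ ℂ (ℝ × ℝ)).contDiff

@[fun_prop]
theorem contDiff_im : ContDiff ℝ ∞ (fun x : Coord => x.1.im) :=
  (imCLM ∘L ContinuousLinearMap.fst ℝ ℂ (ℝ × ℝ)).contDiff

end Coord

open Coord

theorem contDiff_graphMap : ContDiff ℝ ∞ graphMap := by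
  have hz : ContDiff ℝ ∞ (fun x : Coord => x.1) := contDiff_fst
  have hzb : ContDiff ℝ ∞ (fun x : Coord => conj x.1) := conjCLE.contDiff.comp contDiff_fst
  have h₁ : ContDiff ℝ ∞ (fun x : Coord => (x.2.1 : ℂ)) :=
    ofRealCLM.contDiff.comp (contDiff_fst.comp contDiff_snd)
  have h₂ : ContDiff ℝ ∞ (fun x : Coord => (x.2.2 : ℂ)) :=
    ofRealCLM.contDiff.comp (contDiff_snd.comp contDiff_snd)
  unfold graphMap
  fun_prop

theorem fderiv_graphMap (x v : Coord) : fderiv ℝ graphMap x v =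
    (v.1, v.2.1 + I * (v.1 * conj x.1 + x.1 * conj v.1),
      v.2.2 + I * (v.1 * conj x.1 + x.1 * conj v.1) * (x.1 + conj x.1)
        + I * (x.1 * conj x.1) * (v.1 + conj v.1)) := by
  have hz : HasFDerivAt (fun x : Coord => x.1) (ContinuousLinearMap.fst ℝ ℂ (ℝ × ℝ)) x :=
    hasFDerivAt_fst
  have hzb : HasFDerivAt (fun x : Coord => conj x.1)
      ((conjCLE : ℂ →L[ℝ] ℂ) ∘L ContinuousLinearMap.fst ℝ ℂ (ℝ × ℝ)) x :=
    conjCLE.hasFDerivAt.comp x hz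
  have h₁ : HasFDerivAt (fun x : Coord => (x.2.1 : ℂ)) _ x :=
    ofRealCLM.hasFDerivAt.comp x (hasFDerivAt_u₁ x)
  have h₂ : HasFDerivAt (fun x : Coord => (x.2.2 : ℂ)) _ x :=
    ofRealCLM.hasFDerivAt.comp x (hasFDerivAt_u₂ x)
  have hn := (hz.mul hzb).const_mul I
  have h : HasFDerivAt graphMap _ x :=
    hz.prodMk ((h₁.add hn).prodMk (h₂.add (hn.mul (hz.add hzb))))
  rw [h.fderiv]
  refine Prod.ext ?_ (Prod.ext ?_ ?_) <;> simp <;> ring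

/-- The contact form `du₁ - 2y dx + 2x dy`, which vanishes on `T^c`. -/
def contactForm₁ (x v : Coord) : ℝ := v.2.1 - 2 * x.1.im * v.1.re + 2 * x.1.re * v.1.im

/-- The contact form `du₂ - 4xy dx + (6x² + 2y²) dy`, which vanishes on `T^c`. -/
def contactForm₂ (x v : Coord) : ℝ :=
  v.2.2 - 4 * x.1.re * x.1.im * v.1.re + (6 * x.1.re ^ 2 + 2 * x.1.im ^ 2) * v.1.im

/-- The `z`-component says that `w` is `i` times `v` there. Once this is substituted, the imaginary
parts of the other components put `v` in the kernel of the contact forms, and the real parts do the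
same for `w`. -/
theorem fderiv_graphMap_eq_I_smul_iff (x v w : Coord) :
    fderiv ℝ graphMap x w = I • fderiv ℝ graphMap x v ↔
      w.1.re = -v.1.im ∧ w.1.im = v.1.re ∧ contactForm₁ x v = 0 ∧ contactForm₂ x v = 0 ∧
        contactForm₁ x w = 0 ∧ contactForm₂ x w = 0 := by
  rw [fderiv_graphMap, fderiv_graphMap]
  simp only [Prod.ext_iff, Complex.ext_iff, contactForm₁, contactForm₂, Prod.smul_mk, smul_eq_mul,
    mul_re, mul_im, add_re, add_im, I_re, I_im, conj_re, conj_im, ofReal_re, ofReal_im]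
  constructor
  · rintro ⟨⟨h₁, h₂⟩, ⟨h₃, h₄⟩, h₅, h₆⟩
    have h₁' : w.1.re = -v.1.im := by linarith
    have h₂' : w.1.im = v.1.re := by linarith
    rw [h₁', h₂'] at h₃ h₄ h₅ h₆ ⊢
    refine ⟨rfl, rfl, ?_, ?_, ?_, ?_⟩
    · linear_combination -h₄
    · linear_combination -h₆
    · linear_combination h₃
    · linear_combination h₅
  · rintro ⟨h₁, h₂, h₃, h₄, h₅, h₆⟩
    rw [h₁, h₂] at h₅ h₆ ⊢
    refine ⟨⟨by ring, by ring⟩, ⟨?_, ?_⟩, ?_, ?_⟩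
    · linear_combination h₅
    · linear_combination -h₃
    · linear_combination h₆
    · linear_combination -h₄

/-- The section `∂/∂x + 2y ∂/∂u₁ + 4xy ∂/∂u₂` of `T^c`. -/
def frameX (x : Coord) : Coord := (1, 2 * x.1.im, 4 * x.1.re * x.1.im)

/-- The section `∂/∂y - 2x ∂/∂u₁ - (6x² + 2y²) ∂/∂u₂` of `T^c`. -/
def frameY (x : Coord) : Coord := (I, -2 * x.1.re, -(6 * x.1.re ^ 2 + 2 * x.1.im ^ 2))

/-- The field `∂/∂u₁ + 4x ∂/∂u₂`. -/
def frameT (x : Coord) : Coord := (0, 1, 4 * x.1.re)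

/-- The field `∂/∂u₂`. -/
def frameU (_ : Coord) : Coord := (0, 0, 1)

theorem contDiff_frameX : ContDiff ℝ ∞ frameX := by unfold frameX; fun_prop

theorem contDiff_frameY : ContDiff ℝ ∞ frameY := by unfold frameY; fun_prop

theorem contDiff_frameT : ContDiff ℝ ∞ frameT := by unfold frameT; fun_prop

theorem contDiff_frameU : ContDiff ℝ ∞ frameU := contDiff_const

theorem fderiv_frameX (x v : Coord) :
    fderiv ℝ frameX x v = (0, 2 * v.1.im, 4 * (v.1.re * x.1.im + x.1.re * v.1.im)) := by
  have h : HasFDerivAt frameX _ x := (hasFDerivAt_const (1 : ℂ) x).prodMk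
    (((hasFDerivAt_im x).const_mul 2).prodMk (((hasFDerivAt_re x).const_mul 4).mul
      (hasFDerivAt_im x)))
  rw [h.fderiv]
  refine Prod.ext ?_ (Prod.ext ?_ ?_) <;> simp; ring

theorem fderiv_frameY (x v : Coord) : fderiv ℝ frameY x v =
    (0, -2 * v.1.re, -(12 * x.1.re * v.1.re + 4 * x.1.im * v.1.im)) := by
  have h : HasFDerivAt frameY _ x := (hasFDerivAt_const I x).prodMk
    (((hasFDerivAt_re x).const_mul (-2)).prodMk ((((hasFDerivAt_re x).pow 2).const_mul 6).add
      (((hasFDerivAt_im x).pow 2).const_mul 2)).neg)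
  rw [h.fderiv]
  refine Prod.ext ?_ (Prod.ext ?_ ?_) <;> simp; ring

theorem fderiv_frameT (x v : Coord) : fderiv ℝ frameT x v = (0, 0, 4 * v.1.re) := by
  have h : HasFDerivAt frameT _ x := (hasFDerivAt_const (0 : ℂ) x).prodMk
    ((hasFDerivAt_const (1 : ℝ) x).prodMk ((hasFDerivAt_re x).const_mul 4))
  rw [h.fderiv]
  refine Prod.ext ?_ (Prod.ext ?_ ?_) <;> simp

theorem fderiv_frameU (x v : Coord) : fderiv ℝ frameU x v = 0 := by
  change fderiv ℝ (fun _ : Coord => ((0, 0, 1) : Coord)) x v = 0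
  simp

/-- The correction in the last coefficient arises because `contactForm₂` takes the value `4x` on
`frameT`. -/
theorem eq_frame_combination (x v : Coord) :
    v = v.1.re • frameX x + v.1.im • frameY x + contactForm₁ x v • frameT x
      + (contactForm₂ x v - 4 * x.1.re * contactForm₁ x v) • frameU x := by
  refine Prod.ext (Complex.ext ?_ ?_) (Prod.ext ?_ ?_) <;>
    simp [frameX, frameY, frameT, frameU, contactForm₁, contactForm₂] <;> ring

/-! ### Commutation relations of the frame and the associated derivations. -/

section Frame

variable (V : TopologicalSpace.Opens Coord)

open SmoothField

theorem lie_frameX_frameY : ⁅restrict V frameX contDiff_frameX, restrict V frameY contDiff_frameY⁆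
    = (-4 : ℝ) • restrict V frameT contDiff_frameT := ext_on fun x hx => by
  rw [restrict_lie_restrict_apply _ _ hx, fderiv_frameX, fderiv_frameY]
  change _ = (-4 : ℝ) • restrict V frameT contDiff_frameT x
  rw [restrict_apply _ hx]
  refine Prod.ext ?_ (Prod.ext ?_ ?_) <;> simp [frameX, frameY, frameT] <;> ring

theorem lie_frameX_frameT : ⁅restrict V frameX contDiff_frameX, restrict V frameT contDiff_frameT⁆
    = (4 : ℝ) • restrict V frameU contDiff_frameU := ext_on fun x hx => by
  rw [restrict_lie_restrict_apply _ _ hx, fderiv_frameX, fderiv_frameT]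
  change _ = (4 : ℝ) • restrict V frameU contDiff_frameU x
  rw [restrict_apply _ hx]
  refine Prod.ext ?_ (Prod.ext ?_ ?_) <;> simp [frameX, frameT, frameU]

theorem lie_frameY_frameT : ⁅restrict V frameY contDiff_frameY, restrict V frameT contDiff_frameT⁆
    = 0 := ext_on fun x hx => by
  rw [restrict_lie_restrict_apply _ _ hx, fderiv_frameY, fderiv_frameT]
  change _ = (0 : Coord)
  refine Prod.ext ?_ (Prod.ext ?_ ?_) <;> simp [frameY, frameT]

theorem lie_frameX_frameU : ⁅restrict V frameX contDiff_frameX, restrict V frameU contDiff_frameU⁆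
    = 0 := ext_on fun x hx => by
  rw [restrict_lie_restrict_apply _ _ hx, fderiv_frameX, fderiv_frameU]
  change _ = (0 : Coord)
  refine Prod.ext ?_ (Prod.ext ?_ ?_) <;> simp [frameU]

/-- Differentiation of smooth functions along `frameX`. -/
noncomputable def derivX : SmoothFunction V →ₗ[ℝ] SmoothFunction V :=
  SmoothFunction.derivAlong (restrict V frameX contDiff_frameX)

/-- Differentiation of smooth functions along `frameY`. -/
noncomputable def derivY : SmoothFunction V →ₗ[ℝ] SmoothFunction V :=
  SmoothFunction.derivAlong (restrict V frameY contDiff_frameY)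

/-- Differentiation of smooth functions along `frameT`. -/
noncomputable def derivT : SmoothFunction V →ₗ[ℝ] SmoothFunction V :=
  SmoothFunction.derivAlong (restrict V frameT contDiff_frameT)

/-- Differentiation of smooth functions along `frameU`. -/
noncomputable def derivU : SmoothFunction V →ₗ[ℝ] SmoothFunction V :=
  SmoothFunction.derivAlong (restrict V frameU contDiff_frameU)

variable {V} (g : SmoothFunction V)

theorem derivX_apply {x : Coord} (hx : x ∈ V) :
    (derivX V g).1 x = fderiv ℝ g.1 x (frameX x) := by
  rw [derivX, SmoothFunction.derivAlong_apply _ _ hx, restrict_apply _ hx]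

theorem derivY_apply {x : Coord} (hx : x ∈ V) :
    (derivY V g).1 x = fderiv ℝ g.1 x (frameY x) := by
  rw [derivY, SmoothFunction.derivAlong_apply _ _ hx, restrict_apply _ hx]

theorem derivT_apply {x : Coord} (hx : x ∈ V) :
    (derivT V g).1 x = fderiv ℝ g.1 x (frameT x) := by
  rw [derivT, SmoothFunction.derivAlong_apply _ _ hx, restrict_apply _ hx]

theorem derivU_apply {x : Coord} (hx : x ∈ V) :
    (derivU V g).1 x = fderiv ℝ g.1 x (frameU x) := by
  rw [derivU, SmoothFunction.derivAlong_apply _ _ hx, restrict_apply _ hx]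

theorem derivX_derivY :
    derivX V (derivY V g) - derivY V (derivX V g) = (-4 : ℝ) • derivT V g := by
  rw [derivX, derivY, SmoothFunction.derivAlong_lie, lie_frameX_frameY,
    SmoothFunction.derivAlong_smul, derivT]

theorem derivX_derivT :
    derivX V (derivT V g) - derivT V (derivX V g) = (4 : ℝ) • derivU V g := by
  rw [derivX, derivT, SmoothFunction.derivAlong_lie, lie_frameX_frameT,
    SmoothFunction.derivAlong_smul, derivU]

theorem derivY_derivT : derivY V (derivT V g) - derivT V (derivY V g) = 0 := by
  rw [derivY, derivT, SmoothFunction.derivAlong_lie, lie_frameY_frameT,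
    SmoothFunction.derivAlong_zero]

theorem derivX_derivU : derivX V (derivU V g) - derivU V (derivX V g) = 0 := by
  rw [derivX, derivU, SmoothFunction.derivAlong_lie, lie_frameX_frameU,
    SmoothFunction.derivAlong_zero]

variable {g}

/-- The sections of `T^c` generate all vector fields, so that a function annihilated by them
is constant. -/
theorem exists_eq_const_of_derivX_derivY (hV : IsPreconnected (V : Set Coord))
    (hX : derivX V g = 0) (hY : derivY V g = 0) : ∃ k : ℝ, ∀ x ∈ V, g.1 x = k := by
  have hT : derivT V g = 0 := by
    have h := derivX_derivY g
    rw [hX, hY, map_zero, map_zero, sub_zero] at h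
    exact (smul_eq_zero.1 h.symm).resolve_left (by norm_num)
  have hU : derivU V g = 0 := by
    have h := derivX_derivT g
    rw [hX, hT, map_zero, map_zero, sub_zero] at h
    exact (smul_eq_zero.1 h.symm).resolve_left (by norm_num)
  refine V.isOpen.exists_is_const_of_fderiv_eq_zero (𝕜 := ℝ) hV
    (fun x hx => (g.differentiableAt hx).differentiableWithinAt) fun x hx => ?_
  have h₁ : fderiv ℝ g.1 x (frameX x) = 0 := by rw [← derivX_apply g hx, hX]; rfl
  have h₂ : fderiv ℝ g.1 x (frameY x) = 0 := by rw [← derivY_apply g hx, hY]; rfl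
  have h₃ : fderiv ℝ g.1 x (frameT x) = 0 := by rw [← derivT_apply g hx, hT]; rfl
  have h₄ : fderiv ℝ g.1 x (frameU x) = 0 := by rw [← derivU_apply g hx, hU]; rfl
  refine ContinuousLinearMap.ext fun v => ?_
  rw [eq_frame_combination x v]
  simp [h₁, h₂, h₃, h₄]

end Frame

/-! ### The five-parameter family of infinitesimal CR-automorphisms -/

/-- The infinitesimal symmetries of the cubic: the dilation, with parameter `p 0`, and the
generators of a simply transitive nilpotent group, with parameters `p 1, …, p 4`. -/
def symmetryField (p : Fin 5 → ℝ) (x : Coord) : Coord :=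
  (p 1 + p 2 * I + p 0 * x.1,
    p 3 + 2 * p 2 * x.1.re - 2 * p 1 * x.1.im + 2 * p 0 * x.2.1,
    p 4 + 4 * p 1 * (x.2.1 - x.1.re * x.1.im) + 2 * p 2 * (x.1.re ^ 2 - x.1.im ^ 2)
      + 3 * p 0 * x.2.2)

/-- The holomorphic vector field on `ℂ³` that extends `symmetryField p`. -/
def holomorphicSymmetryField (p : Fin 5 → ℝ) (q : ℂ × ℂ × ℂ) : ℂ × ℂ × ℂ :=
  (p 1 + p 2 * I + p 0 * q.1,
    p 3 + 2 * (p 2 + p 1 * I) * q.1 + 2 * p 0 * q.2.1,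
    p 4 + 4 * p 1 * q.2.1 + 2 * (p 2 + p 1 * I) * q.1 ^ 2 + 3 * p 0 * q.2.2)

theorem contDiff_symmetryField (p : Fin 5 → ℝ) : ContDiff ℝ ∞ (symmetryField p) := by
  unfold symmetryField
  fun_prop

theorem fderiv_symmetryField (p : Fin 5 → ℝ) (x v : Coord) : fderiv ℝ (symmetryField p) x v =
    (p 0 * v.1, 2 * p 2 * v.1.re - 2 * p 1 * v.1.im + 2 * p 0 * v.2.1,
      4 * p 1 * (v.2.1 - (v.1.re * x.1.im + x.1.re * v.1.im))
        + 2 * p 2 * (2 * x.1.re * v.1.re - 2 * x.1.im * v.1.im) + 3 * p 0 * v.2.2) := by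
  have h : HasFDerivAt (symmetryField p) _ x :=
    (((hasFDerivAt_fst (𝕜 := ℝ) (p := x)).const_mul (p 0 : ℂ)).const_add (p 1 + p 2 * I)).prodMk
      (((((hasFDerivAt_re x).const_mul (2 * p 2)).const_add (p 3)).sub
        ((hasFDerivAt_im x).const_mul (2 * p 1))).add ((hasFDerivAt_u₁ x).const_mul (2 * p 0))
      |>.prodMk <|
      ((((((hasFDerivAt_u₁ x).sub ((hasFDerivAt_re x).mul (hasFDerivAt_im x))).const_mul
        (4 * p 1)).const_add (p 4)).add ((((hasFDerivAt_re x).pow 2).sub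
        ((hasFDerivAt_im x).pow 2)).const_mul (2 * p 2))).add
        ((hasFDerivAt_u₂ x).const_mul (3 * p 0))))
  rw [h.fderiv]
  refine Prod.ext ?_ (Prod.ext ?_ ?_) <;> simp [-mul_eq_mul_left_iff]; ring

/-- Expresses that the holomorphic field is tangent to the cubic. -/
theorem fderiv_graphMap_symmetryField (p : Fin 5 → ℝ) (x : Coord) :
    fderiv ℝ graphMap x (symmetryField p x) = holomorphicSymmetryField p (graphMap x) := by
  rw [fderiv_graphMap]
  refine Prod.ext rfl (Prod.ext (Complex.ext ?_ ?_) (Complex.ext ?_ ?_)) <;>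
    simp [symmetryField, holomorphicSymmetryField, graphMap, pow_two] <;> ring

theorem differentiable_holomorphicSymmetryField (p : Fin 5 → ℝ) :
    Differentiable ℂ (holomorphicSymmetryField p) := by
  unfold holomorphicSymmetryField
  fun_prop

/-- The restriction of a holomorphic vector field that is tangent to the cubic is an infinitesimal
CR-automorphism. -/
theorem mem_autCR_of_holomorphic {U : TopologicalSpace.Opens cubic}
    {X : SmoothField (coordDomain U)} {H : ℂ × ℂ × ℂ → ℂ × ℂ × ℂ} (hH : Differentiable ℂ H)
    (hX : ∀ x ∈ coordDomain U, fderiv ℝ graphMap x (X x) = H (graphMap x)) : X ∈ autCR U := by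
  intro Y Z h x hx
  have hG : DifferentiableAt ℝ graphMap x := contDiff_graphMap.contDiffAt.differentiableAt (by simp)
  -- Differentiating `dG(X) = H ∘ G`, with `G = graphMap`, puts the derivative of `H` in the second
  -- term. That derivative is complex linear, so multiplication by `I` passes through it.
  have key : ∀ W : SmoothField (coordDomain U), fderiv ℝ graphMap x (⁅X, W⁆ x) =
      fderiv ℝ (fun y => fderiv ℝ graphMap y (W y)) x (X x)
        - fderiv ℂ H (graphMap x) (fderiv ℝ graphMap x (W x)) := by
    intro W
    have hev : (fun y => fderiv ℝ graphMap y (X y)) =ᶠ[nhds x] H ∘ graphMap := by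
      filter_upwards [(coordDomain U).isOpen.mem_nhds hx] with y hy using hX y hy
    rw [SmoothField.bracket_apply _ _ hx, fderiv_apply_lieBracket contDiff_graphMap.contDiffAt
      (X.differentiableAt hx) (W.differentiableAt hx), hev.fderiv_eq,
      (((hH (graphMap x)).hasFDerivAt.restrictScalars ℝ).comp x hG.hasFDerivAt).fderiv]
    rfl
  have hev : (fun y => fderiv ℝ graphMap y (Z y)) =ᶠ[nhds x]
      fun y => I • fderiv ℝ graphMap y (Y y) := by
    filter_upwards [(coordDomain U).isOpen.mem_nhds hx] with y hy using h y hy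
  have hd : DifferentiableAt ℝ (fun y => fderiv ℝ graphMap y (Y y)) x :=
    ((contDiff_graphMap.contDiffAt.fderiv_right (m := ∞) (by simp)).differentiableAt
      (by simp)).clm_apply (Y.differentiableAt hx)
  rw [key, key, hev.fderiv_eq, h x hx, map_smul, smul_sub, fderiv_fun_const_smul hd]
  rfl

/-- The infinitesimal symmetries of the cubic as elements of `autCR U`. -/
noncomputable def symmetry (U : TopologicalSpace.Opens cubic) : (Fin 5 → ℝ) →ₗ[ℝ] autCR U where
  toFun p := ⟨SmoothField.restrict _ (symmetryField p) (contDiff_symmetryField p),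
    mem_autCR_of_holomorphic (differentiable_holomorphicSymmetryField p) fun x hx => by
      rw [SmoothField.restrict_apply _ hx, fderiv_graphMap_symmetryField]⟩
  map_add' p q := Subtype.ext <| SmoothField.ext_on fun x hx => by
    change _ = SmoothField.restrict _ (symmetryField p) (contDiff_symmetryField p) x
      + SmoothField.restrict _ (symmetryField q) (contDiff_symmetryField q) x
    rw [SmoothField.restrict_apply _ hx, SmoothField.restrict_apply _ hx,
      SmoothField.restrict_apply _ hx]
    refine Prod.ext ?_ (Prod.ext ?_ ?_) <;> simp [symmetryField] <;> ring
  map_smul' c p := Subtype.ext <| SmoothField.ext_on fun x hx => by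
    change _ = c • SmoothField.restrict _ (symmetryField p) (contDiff_symmetryField p) x
    rw [SmoothField.restrict_apply _ hx, SmoothField.restrict_apply _ hx]
    refine Prod.ext ?_ (Prod.ext ?_ ?_) <;> simp [symmetryField] <;> ring

theorem symmetry_apply {U : TopologicalSpace.Opens cubic} (p : Fin 5 → ℝ) {x : Coord}
    (hx : x ∈ coordDomain U) : (symmetry U p).1 x = symmetryField p x :=
  SmoothField.restrict_apply (contDiff_symmetryField p) hx

/-- The algebra is graded: the dilation acts with weights 1, 1, 2, 3, and the other nonzero brackets
pair parameters 1, 2 into 3 and 1, 3 into 4. The structure equations are dual to this table. -/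
theorem lie_symmetry {U : TopologicalSpace.Opens cubic} (p q : Fin 5 → ℝ) :
    ⁅symmetry U p, symmetry U q⁆ = symmetry U ![0,
      p 1 * q 0 - p 0 * q 1, p 2 * q 0 - p 0 * q 2,
      2 * (p 3 * q 0 - p 0 * q 3) + 4 * (p 1 * q 2 - p 2 * q 1),
      3 * (p 4 * q 0 - p 0 * q 4) + 4 * (p 3 * q 1 - p 1 * q 3)] :=
  Subtype.ext <| SmoothField.ext_on fun x hx => by
    refine (SmoothField.restrict_lie_restrict_apply (contDiff_symmetryField p)
      (contDiff_symmetryField q) hx).trans ?_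
    rw [symmetry_apply _ hx, fderiv_symmetryField, fderiv_symmetryField]
    refine Prod.ext (Complex.ext ?_ ?_) (Prod.ext ?_ ?_) <;> simp [symmetryField] <;> ring

theorem symmetry_injective {U : TopologicalSpace.Opens cubic}
    (hU : (U : Set cubic).Nonempty) : Function.Injective (symmetry U) := by
  obtain ⟨y, hy⟩ := hU
  rw [← LinearMap.ker_eq_bot, LinearMap.ker_eq_bot']
  intro p hp
  set x := graphHomeo.symm ⟨y, y.2⟩ with hx_def
  have hx : x ∈ coordDomain U := by
    change graphHomeo x ∈ U
    simpa [hx_def] using hy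
  have h : ∀ y ∈ coordDomain U, symmetryField p y = 0 := fun y hy => by
    rw [← symmetry_apply p hy, hp]
    rfl
  have hev : symmetryField p =ᶠ[nhds x] fun _ => 0 := by
    filter_upwards [(coordDomain U).isOpen.mem_nhds hx] with y hy using h y hy
  -- A value at one point gives only four real conditions, so the dilation parameter is read off
  -- from a derivative; this uses vanishing near `x`.
  have h₀ : p 0 = 0 := by
    have := congrArg (fun v : Coord => v.1.re) (fderiv_symmetryField p x (1, 0, 0))
    simpa [hev.fderiv_eq] using this.symm
  have hv := h x hx
  simp only [symmetryField, h₀, Prod.ext_iff, Complex.ext_iff] at hv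
  obtain ⟨⟨h₁, h₂⟩, h₃, h₄⟩ := hv
  simp at h₁ h₂
  simp [h₁, h₂] at h₃ h₄
  funext i
  fin_cases i <;> simp [*]

/-! ### All infinitesimal CR-automorphisms -/

section Coefficients

variable {V : TopologicalSpace.Opens Coord} (X : SmoothField V)

/-- The coefficient of `frameX` in a vector field. -/
noncomputable def coeffX : SmoothFunction V :=
  ⟨fun x => (X x).1.re, contDiff_re.comp_contDiffOn X.2.1, fun x hx => by simp [X.2.2 x hx]⟩

/-- The coefficient of `frameY` in a vector field. -/
noncomputable def coeffY : SmoothFunction V :=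
  ⟨fun x => (X x).1.im, contDiff_im.comp_contDiffOn X.2.1, fun x hx => by simp [X.2.2 x hx]⟩

theorem contDiff_contactForm₁ : ContDiff ℝ ∞ (fun y : Coord × Coord => contactForm₁ y.1 y.2) := by
  have h₁ : ContDiff ℝ ∞ (fun y : Coord × Coord => y.1.1.re) := contDiff_re.comp contDiff_fst
  have h₂ : ContDiff ℝ ∞ (fun y : Coord × Coord => y.1.1.im) := contDiff_im.comp contDiff_fst
  have h₃ : ContDiff ℝ ∞ (fun y : Coord × Coord => y.2.1.re) := contDiff_re.comp contDiff_snd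
  have h₄ : ContDiff ℝ ∞ (fun y : Coord × Coord => y.2.1.im) := contDiff_im.comp contDiff_snd
  unfold contactForm₁
  fun_prop

theorem contDiff_contactForm₂ : ContDiff ℝ ∞ (fun y : Coord × Coord => contactForm₂ y.1 y.2) := by
  have h₁ : ContDiff ℝ ∞ (fun y : Coord × Coord => y.1.1.re) := contDiff_re.comp contDiff_fst
  have h₂ : ContDiff ℝ ∞ (fun y : Coord × Coord => y.1.1.im) := contDiff_im.comp contDiff_fst
  have h₃ : ContDiff ℝ ∞ (fun y : Coord × Coord => y.2.1.re) := contDiff_re.comp contDiff_snd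
  have h₄ : ContDiff ℝ ∞ (fun y : Coord × Coord => y.2.1.im) := contDiff_im.comp contDiff_snd
  unfold contactForm₂
  fun_prop

/-- The coefficient of `frameT` in a vector field. -/
noncomputable def coeffT : SmoothFunction V :=
  ⟨fun x => contactForm₁ x (X x), contDiff_contactForm₁.comp_contDiffOn (contDiffOn_id.prodMk X.2.1),
    fun x hx => by simp [contactForm₁, X.2.2 x hx]⟩

/-- The coefficient of `frameU` in a vector field. -/
noncomputable def coeffU : SmoothFunction V :=
  ⟨fun x => contactForm₂ x (X x) - 4 * x.1.re * contactForm₁ x (X x),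
    (contDiff_contactForm₂.comp_contDiffOn (contDiffOn_id.prodMk X.2.1)).sub
      ((contDiff_const.mul contDiff_re).contDiffOn.mul
        (contDiff_contactForm₁.comp_contDiffOn (contDiffOn_id.prodMk X.2.1))),
    fun x hx => by simp [contactForm₁, contactForm₂, X.2.2 x hx]⟩

variable {x : Coord}

theorem fderiv_coeffX (hx : x ∈ V) (v : Coord) : fderiv ℝ (coeffX X).1 x v = (fderiv ℝ X x v).1.re := by
  have h : HasFDerivAt (coeffX X).1 _ x :=
    (hasFDerivAt_re (X x)).comp x (X.differentiableAt hx).hasFDerivAt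
  rw [h.fderiv]
  rfl

theorem fderiv_coeffY (hx : x ∈ V) (v : Coord) : fderiv ℝ (coeffY X).1 x v = (fderiv ℝ X x v).1.im := by
  have h : HasFDerivAt (coeffY X).1 _ x :=
    (hasFDerivAt_im (X x)).comp x (X.differentiableAt hx).hasFDerivAt
  rw [h.fderiv]
  rfl

/-- The terms without the derivative of `X` come from differentiating the coefficients of the
contact form. -/
theorem fderiv_coeffT (hx : x ∈ V) (v : Coord) : fderiv ℝ (coeffT X).1 x v = contactForm₁ x (fderiv ℝ X x v)
    - 2 * v.1.im * (X x).1.re + 2 * v.1.re * (X x).1.im := by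
  have hX := (X.differentiableAt hx).hasFDerivAt
  have h : HasFDerivAt (coeffT X).1 _ x :=
    (((hasFDerivAt_u₁ (X x)).comp x hX).sub (((hasFDerivAt_im x).const_mul 2).mul
      ((hasFDerivAt_re (X x)).comp x hX))).add (((hasFDerivAt_re x).const_mul 2).mul
      ((hasFDerivAt_im (X x)).comp x hX))
  rw [h.fderiv]
  simp [contactForm₁]
  ring

theorem fderiv_coeffU (hx : x ∈ V) (v : Coord) : fderiv ℝ (coeffU X).1 x v = contactForm₂ x (fderiv ℝ X x v)
    - 4 * x.1.re * contactForm₁ x (fderiv ℝ X x v) - 4 * v.1.re * (X x).2.1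
    + 4 * (v.1.re * x.1.im + x.1.re * v.1.im) * (X x).1.re
    + (4 * x.1.im * v.1.im - 4 * x.1.re * v.1.re) * (X x).1.im := by
  have hX := (X.differentiableAt hx).hasFDerivAt
  have ha := (hasFDerivAt_re (X x)).comp x hX
  have hb := (hasFDerivAt_im (X x)).comp x hX
  have h : HasFDerivAt (coeffU X).1 _ x :=
    ((((hasFDerivAt_u₂ (X x)).comp x hX).sub ((((hasFDerivAt_re x).const_mul 4).mul
      (hasFDerivAt_im x)).mul ha)).add (((((hasFDerivAt_re x).pow 2).const_mul 6).add
      (((hasFDerivAt_im x).pow 2).const_mul 2)).mul hb)).sub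
      (((hasFDerivAt_re x).const_mul 4).mul
      ((((hasFDerivAt_u₁ (X x)).comp x hX).sub (((hasFDerivAt_im x).const_mul 2).mul ha)).add
        (((hasFDerivAt_re x).const_mul 2).mul hb)))
  rw [h.fderiv]
  simp [contactForm₁, contactForm₂]
  ring

end Coefficients

/-! ### Determining equations and the bound on the dimension. -/

theorem isCRPair_frame (U : TopologicalSpace.Opens cubic) :
    IsCRPair (SmoothField.restrict (coordDomain U) frameX contDiff_frameX)
      (SmoothField.restrict (coordDomain U) frameY contDiff_frameY) := fun x hx => by
  rw [SmoothField.restrict_apply _ hx, SmoothField.restrict_apply _ hx,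
    fderiv_graphMap_eq_I_smul_iff]
  refine ⟨?_, ?_, ?_, ?_, ?_, ?_⟩ <;> simp [frameX, frameY, contactForm₁, contactForm₂]

/-- The equations for infinitesimal CR-automorphisms in terms of their coefficients. -/
theorem autCR_equations {U : TopologicalSpace.Opens cubic} {X : SmoothField (coordDomain U)}
    (hX : X ∈ autCR U) :
    derivX _ (coeffT X) = (4 : ℝ) • coeffY X ∧ derivY _ (coeffT X) = (-4 : ℝ) • coeffX X ∧
    derivX _ (coeffU X) = (-4 : ℝ) • coeffT X ∧ derivY _ (coeffU X) = 0 ∧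
    derivX _ (coeffX X) = derivY _ (coeffY X) ∧ derivY _ (coeffX X) = -derivX _ (coeffY X) := by
  have key : ∀ x ∈ coordDomain U, _ := fun x hx => by
    -- Testing on this one pair suffices: only necessary conditions are needed for the upper bound.
    have h := hX _ _ (isCRPair_frame U) x hx
    rw [SmoothField.lie_restrict_apply _ _ hx, SmoothField.lie_restrict_apply _ _ hx,
      fderiv_graphMap_eq_I_smul_iff, fderiv_frameX, fderiv_frameY] at h
    simp only [contactForm₁, contactForm₂, Prod.fst_sub, Prod.snd_sub, sub_re, sub_im, zero_re,
      zero_im] at h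
    exact h
  refine ⟨?_, ?_, ?_, ?_, ?_, ?_⟩ <;> refine SmoothFunction.ext_on fun x hx => ?_ <;>
    obtain ⟨h₁, h₂, h₃, h₄, h₅, h₆⟩ := key x hx
  · rw [derivX_apply _ hx, fderiv_coeffT _ hx]
    change _ = 4 * (X x).1.im
    simp [frameX, contactForm₁] at h₃ ⊢
    linear_combination -h₃
  · rw [derivY_apply _ hx, fderiv_coeffT _ hx]
    change _ = -4 * (X x).1.re
    simp [frameY, contactForm₁] at h₅ ⊢
    linear_combination -h₅
  · rw [derivX_apply _ hx, fderiv_coeffU _ hx]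
    change _ = -4 * contactForm₁ x (X x)
    simp [frameX, contactForm₁, contactForm₂] at h₃ h₄ ⊢
    linear_combination -h₄ + 4 * x.1.re * h₃
  · rw [derivY_apply _ hx, fderiv_coeffU _ hx]
    change _ = 0
    simp [frameY, contactForm₁, contactForm₂] at h₅ h₆ ⊢
    linear_combination -h₆ + 4 * x.1.re * h₅
  · rw [derivX_apply _ hx, derivY_apply _ hx, fderiv_coeffX _ hx, fderiv_coeffY _ hx]
    linear_combination h₂
  · change _ = -(derivX _ (coeffY X)).1 x
    rw [derivX_apply _ hx, derivY_apply _ hx, fderiv_coeffX _ hx, fderiv_coeffY _ hx]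
    linear_combination -h₁

theorem eq_zero_of_derivX_derivY {V : TopologicalSpace.Opens Coord} {g : SmoothFunction V}
    (hV : IsPreconnected (V : Set Coord)) {x : Coord} (hx : x ∈ V) (h : g.1 x = 0)
    (hX : derivX V g = 0) (hY : derivY V g = 0) : g = 0 := by
  obtain ⟨k, hk⟩ := exists_eq_const_of_derivX_derivY hV hX hY
  exact SmoothFunction.ext_on fun y hy => by rw [hk y hy, ← hk x hx, h]; rfl

/-- An infinitesimal CR-automorphism of a connected open set is determined by its value and one
of its first derivatives at a point. -/
theorem autCR_eq_zero {U : TopologicalSpace.Opens cubic} {X : SmoothField (coordDomain U)}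
    (hX : X ∈ autCR U) (hU : IsPreconnected (coordDomain U : Set Coord)) {x : Coord}
    (hx : x ∈ coordDomain U) (h : X x = 0) (h' : (fderiv ℝ X x (frameX x)).1.re = 0) : X = 0 := by
  obtain ⟨h₁c, h₂c, h₁d, h₂d, hab, hba⟩ := autCR_equations hX
  obtain ⟨h₂a, h₁b, h₁₁a, h₂₁a⟩ := prolongation derivX_derivY derivX_derivT derivY_derivT
    derivX_derivU h₁c h₂c h₁d h₂d hab hba
  -- The coefficients vanish in the order `Xa`, then `a` and `b`, then `c`, then `d`: each has zero
  -- derivative along `X` and `Y` once its predecessors vanish, and is zero at `x`.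
  have h₁a : derivX _ (coeffX X) = 0 := eq_zero_of_derivX_derivY hU hx
    (by rw [derivX_apply _ hx, fderiv_coeffX _ hx, h']) h₁₁a h₂₁a
  have ha : coeffX X = 0 := eq_zero_of_derivX_derivY hU hx (by simp [coeffX, h]) h₁a h₂a
  have hb : coeffY X = 0 :=
    eq_zero_of_derivX_derivY hU hx (by simp [coeffY, h]) h₁b (hab ▸ h₁a)
  rw [ha, smul_zero] at h₂c
  rw [hb, smul_zero] at h₁c
  have hc : coeffT X = 0 :=
    eq_zero_of_derivX_derivY hU hx (by simp [coeffT, contactForm₁, h]) h₁c h₂c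
  rw [hc, smul_zero] at h₁d
  have hd : coeffU X = 0 :=
    eq_zero_of_derivX_derivY hU hx (by simp [coeffU, contactForm₁, contactForm₂, h]) h₁d h₂d
  refine SmoothField.ext_on fun y _ => ?_
  have ea : (X y).1.re = 0 := congrArg (fun g => g.1 y) ha
  have eb : (X y).1.im = 0 := congrArg (fun g => g.1 y) hb
  have ec : contactForm₁ y (X y) = 0 := congrArg (fun g => g.1 y) hc
  have ed : contactForm₂ y (X y) - 4 * y.1.re * contactForm₁ y (X y) = 0 :=
    congrArg (fun g => g.1 y) hd
  rw [eq_frame_combination y (X y), ea, eb, ed, ec]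
  simp

/-- The data at a point that determine an infinitesimal CR-automorphism. -/
noncomputable def autCREval (U : TopologicalSpace.Opens cubic) {x : Coord}
    (hx : x ∈ coordDomain U) : autCR U →ₗ[ℝ] Coord × ℝ where
  toFun X := (X.1 x, (fderiv ℝ X.1 x (frameX x)).1.re)
  map_add' X Y := by
    have h : fderiv ℝ (X + Y).1 x = fderiv ℝ X.1 x + fderiv ℝ Y.1 x :=
      fderiv_add (X.1.differentiableAt hx) (Y.1.differentiableAt hx)
    rw [h]
    rfl
  map_smul' c X := by
    have h : fderiv ℝ (c • X).1 x = c • fderiv ℝ X.1 x :=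
      fderiv_const_smul (X.1.differentiableAt hx) c
    rw [h]
    refine Prod.ext rfl ?_
    simp

/-- A dimension count replaces solving the equations: `symmetry` embeds a space of dimension 5, and
evaluation embeds `autCR U` into `Coord × ℝ`, also of dimension 5. -/
theorem symmetry_bijective {U : TopologicalSpace.Opens cubic} (hU : IsConnected (U : Set cubic)) :
    Function.Bijective (symmetry U) := by
  have hV : IsConnected (coordDomain U : Set Coord) := graphHomeo.isConnected_preimage.2 hU
  obtain ⟨x, hx⟩ := hV.nonempty
  have hi : Function.Injective (autCREval U hx) := by
    rw [← LinearMap.ker_eq_bot, LinearMap.ker_eq_bot']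
    intro X hX
    exact Subtype.ext (autCR_eq_zero X.2 hV.isPreconnected hx (congrArg Prod.fst hX)
      (congrArg Prod.snd hX))
  have hs := symmetry_injective hU.nonempty
  have : Module.Finite ℝ (autCR U) := Module.Finite.of_injective _ hi
  have h₁ := LinearMap.finrank_le_finrank_of_injective hi
  have h₂ := LinearMap.finrank_le_finrank_of_injective hs
  simp only [Module.finrank_prod, Module.finrank_self, Complex.finrank_real_complex,
    Module.finrank_fin_fun] at h₁ h₂
  refine ⟨hs, (LinearMap.injective_iff_surjective_of_finrank_eq_finrank ?_).1 hs⟩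
  rw [Module.finrank_fin_fun]
  omega

/-- The parameters of an infinitesimal CR-automorphism of a connected open set. -/
noncomputable def symmetryEquiv {U : TopologicalSpace.Opens cubic}
    (hU : IsConnected (U : Set cubic)) : (Fin 5 → ℝ) ≃ₗ[ℝ] autCR U :=
  LinearEquiv.ofBijective (symmetry U) (symmetry_bijective hU)

/-! ### Maurer–Cartan forms -/

/-- The complex-valued form on `L` with the complex coefficients `k` in the coordinates `e`. -/
noncomputable def MCForm.ofCoeff {L : Type*} [LieRing L] [LieAlgebra ℝ L] {n : ℕ}
    (e : (Fin n → ℝ) ≃ₗ[ℝ] L) (k : Fin n → ℂ) : MCForm L where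
  toFun X := ∑ i, k i * e.symm X i
  map_add' X Y := by simp [mul_add, Finset.sum_add_distrib]
  map_smul' c X := by simp [Finset.mul_sum, mul_left_comm]

theorem MCForm.ofCoeff_apply {L : Type*} [LieRing L] [LieAlgebra ℝ L] {n : ℕ}
    (e : (Fin n → ℝ) ≃ₗ[ℝ] L) (k : Fin n → ℂ) (p : Fin n → ℝ) :
    MCForm.ofCoeff e k (e p) = ∑ i, k i * p i := by
  simp [MCForm.ofCoeff]

theorem MCForm.bar_ofCoeff {L : Type*} [LieRing L] [LieAlgebra ℝ L] {n : ℕ}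
    (e : (Fin n → ℝ) ≃ₗ[ℝ] L) (k : Fin n → ℂ) :
    (MCForm.ofCoeff e k).bar = MCForm.ofCoeff e (fun i => conj (k i)) := by
  ext X
  simp [MCForm.bar, MCForm.ofCoeff]

theorem theorem1 (U : TopologicalSpace.Opens cubic) (hU : IsConnected (U : Set cubic)) :
    Module.finrank ℝ (autCR U) = 5 ∧
    ∃ σ ρ ζ α : MCForm (autCR U),
      (σ.bar = σ ∧ ρ.bar = ρ ∧ α.bar = α) ∧
      (∃ b : Module.Basis (Fin 5) ℂ (MCForm (autCR U)), ⇑b = ![σ, ρ, ζ, ζ.bar, α]) ∧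
      σ.d = (3 : ℂ) • α.wedge σ + ρ.wedge ζ + ρ.wedge ζ.bar ∧
      ρ.d = (2 : ℂ) • α.wedge ρ + Complex.I • ζ.wedge ζ.bar ∧
      ζ.d = α.wedge ζ ∧
      ζ.bar.d = α.wedge ζ.bar ∧
      α.d = 0 := by
  set e := symmetryEquiv hU with he
  have hrank : Module.finrank ℝ (autCR U) = 5 := by
    rw [← e.finrank_eq, Module.finrank_fin_fun]
  have : Module.Finite ℝ (autCR U) := Module.Finite.equiv e
  have hlie : ∀ p q, ⁅e p, e q⁆ = e _ := lie_symmetry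
  have hfun : ∀ s t : autCR U → autCR U → ℂ, (∀ p q, s (e p) (e q) = t (e p) (e q)) → s = t := by
    intro s t h
    funext X Y
    rw [← e.apply_symm_apply X, ← e.apply_symm_apply Y]
    exact h _ _
  -- With `ζ = p 1 + i p 2` and `α = p 0`, the factor `-1 / 2` normalizes the coefficient of `ζ ∧
  -- ζ.bar` in `dρ` to `i`; then `1 / 4` normalizes those of `ρ ∧ ζ` and `ρ ∧ ζ.bar` in `dσ` to 1.
  refine ⟨hrank, MCForm.ofCoeff e ![0, 0, 0, 0, 1 / 4], MCForm.ofCoeff e ![0, 0, 0, -1 / 2, 0],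
    MCForm.ofCoeff e ![0, 1, I, 0, 0], MCForm.ofCoeff e ![1, 0, 0, 0, 0], ⟨?_, ?_, ?_⟩, ?_, ?_⟩
  · rw [MCForm.bar_ofCoeff]
    congr 1; funext i; fin_cases i <;> simp [map_ofNat]
  · rw [MCForm.bar_ofCoeff]
    congr 1; funext i; fin_cases i <;> simp [map_ofNat]
  · rw [MCForm.bar_ofCoeff]
    congr 1; funext i; fin_cases i <;> simp
  · have hli : LinearIndependent ℂ ![MCForm.ofCoeff e ![0, 0, 0, 0, 1 / 4],
        MCForm.ofCoeff e ![0, 0, 0, -1 / 2, 0], MCForm.ofCoeff e ![0, 1, I, 0, 0],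
        (MCForm.ofCoeff e ![0, 1, I, 0, 0]).bar, MCForm.ofCoeff e ![1, 0, 0, 0, 0]] := by
      rw [Fintype.linearIndependent_iff]
      intro g hg
      have h : ∀ p, _ := fun p => LinearMap.congr_fun hg (e p)
      simp only [Fin.sum_univ_five, MCForm.bar_ofCoeff, LinearMap.add_apply, LinearMap.smul_apply,
        LinearMap.zero_apply] at h
      have h₀ := h ![1, 0, 0, 0, 0]
      have h₁ := h ![0, 1, 0, 0, 0]
      have h₂ := h ![0, 0, 1, 0, 0]
      have h₃ := h ![0, 0, 0, 1, 0]
      have h₄ := h ![0, 0, 0, 0, 1]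
      simp [MCForm.ofCoeff_apply, Fin.sum_univ_five] at h₀ h₁ h₂ h₃ h₄
      -- Evaluation on the second horizontal generator gives `i` times this difference, while `h₁`
      -- gives the sum.
      have h₂' : g 2 - g 3 = 0 := by
        linear_combination -I * h₂ + (g 2 - g 3) * I_mul_I
      have e₂ : g 2 = 0 := by linear_combination (h₁ + h₂') / 2
      have e₃ : g 3 = 0 := by linear_combination (h₁ - h₂') / 2
      intro i
      fin_cases i <;> simp [*]
    refine ⟨basisOfLinearIndependentOfCardEqFinrank hli ?_,
      coe_basisOfLinearIndependentOfCardEqFinrank _ _⟩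
    rw [Module.finrank_linearMap, hrank, Module.finrank_self, Fintype.card_fin]
  · refine ⟨?_, ?_, ?_, ?_, ?_⟩ <;> refine hfun _ _ fun p q => ?_ <;>
      simp [MCForm.bar_ofCoeff, MCForm.d, MCForm.wedge, hlie, MCForm.ofCoeff_apply,
        Fin.sum_univ_five]
    · ring
    · linear_combination (2 * (p 1 * q 2 - p 2 * q 1) : ℂ) * I_mul_I
    · ring
    · ring
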